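/- Let $p\ge 2$ be even and let $\alpha_0,\dots,\alpha_{p-1}\in\mathbb D=\{z\in\mathbb C:|z|<1\}$, extended to a $p$-periodic sequence $(\alpha_j)_{j\ge 0}$. For a polynomial $P(z)=\sum_{l=0}^k c_lz^l$ of degree $k$ put $P^*(z)=\sum_{l=0}^k\bar c_{k-l}z^l$. Let $\Phi_0=1$, $\Phi_{k+1}(z)=z\Phi_k(z)-\bar\alpha_k\Phi_k^*(z)$, $\rho_k=\sqrt{1-|\alpha_k|^2}$ and $\varphi_k=\Phi_k/(\rho_0\cdots\rho_{k-1})$. For every probability measure on the unit circle $S^1$ whose Verblunsky coefficients are $(\alpha_j)_{j\ge0}$ (that is, whose monic orthogonal polynomials obey this recurrence), the $\Phi_k$ are the monic orthogonal polynomials and the $\varphi_k$ are the orthonormal polynomials. The polynomial $\Phi_p-\Phi_p^*$ has exactly $p$ distinct zeros $z_1,\dots,z_p$ (the positions of the Dirichlet data), and they all lie on $S^1$. Put $$\tilde\alpha_j=\alpha_j\quad(0\le j\le p-2),\qquad \tilde\alpha_{p-1}=\frac{1+\alpha_{p-1}}{1+\bar\alpha_{p-1}}\in S^1,\qquad \tilde\rho_j=\sqrt{1-|\tilde\alpha_j|^2},$$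 and let $\mathcal C=\mathcal L\mathcal M$ be the associated finite $p\times p$ CMV matrix, where $$\mathcal L=\operatorname{diag}(\Theta_0,\Theta_2,\dots,\Theta_{p-2}),\quad \mathcal M=\operatorname{diag}([1],\Theta_1,\Theta_3,\dots,\Theta_{p-3},[\overline{\tilde\alpha_{p-1}}]),\quad \Theta_j=\begin{bmatrix}\overline{\tilde\alpha_j}&\tilde\rho_j\\ \tilde\rho_j&-\tilde\alpha_j\end{bmatrix}.$$ Then $\mathcal C$ is unitary, and the spectral measure of $\mathcal C$ and the vector $e_1=[1\,0\,\dots\,0]^T$ is $$d\tilde\mu=\sum_{j=1}^p w_j\,\delta_{z_j},\qquad w_j=\left[\left.\frac{d}{dr}\right|_{r=1}|\varphi_p(rz_j)|^2-p\,|\varphi_p(z_j)|^2\right]^{-1}>0 .$$ In particular, the eigenvalues of $\mathcal C$ are exactly $z_1,\dots,z_p$. -/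

import Mathlib

open Polynomial MeasureTheory ComplexConjugate

namespace OPUC

noncomputable section

/-- The reversed polynomial `P^*` of a polynomial `P` of degree at most `k`: the coefficient of
`z ^ l` in `P^*` is the conjugate of the coefficient of `z ^ (k - l)` in `P`, for `l ≤ k`. -/
def reversed (k : ℕ) (P : ℂ[X]) : ℂ[X] :=
  Polynomial.reflect k (P.map (starRingEnd ℂ))

/-- The monic orthogonal polynomials `Φ_k` with Verblunsky coefficients `α`, given by the
recurrence `Φ_0 = 1`, `Φ_{k+1}(z) = z Φ_k(z) - conj (α_k) Φ_k^*(z)`. -/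
def Phi (α : ℕ → ℂ) : ℕ → ℂ[X]
  | 0 => 1
  | k + 1 => X * Phi α k - C (conj (α k)) * reversed k (Phi α k)

/-- `ρ_k = sqrt (1 - |α_k| ^ 2)`. -/
def rho (α : ℕ → ℂ) (k : ℕ) : ℝ := Real.sqrt (1 - ‖α k‖ ^ 2)

/-- The orthonormal polynomials `φ_k = Φ_k / ‖Φ_k‖`, where `‖Φ_k‖ = ρ_0 ⋯ ρ_{k-1}`. -/
def phi (α : ℕ → ℂ) (k : ℕ) : ℂ[X] :=
  C ((∏ j ∈ Finset.range k, (rho α j : ℂ))⁻¹) * Phi α k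

/-- `P` is a monic polynomial of degree `n` that is orthogonal in `L²(μ)` to all polynomials of
smaller degree. -/
structure IsMonicOrthogonal (μ : Measure ℂ) (n : ℕ) (P : ℂ[X]) : Prop where
  monic : P.Monic
  natDegree_eq : P.natDegree = n
  orthogonal : ∀ Q : ℂ[X], Q.degree < n → ∫ z : ℂ, conj (Q.eval z) * P.eval z ∂μ = 0

/-- `μ` is supported on the unit circle, and the infinite sequence `α` consists of its Verblunsky
coefficients: the monic orthogonal polynomials of `μ` obey the recurrence with coefficients `α`. -/
def HasVerblunskyCoeffs (μ : Measure ℂ) (α : ℕ → ℂ) : Prop :=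
  (∀ᵐ z ∂μ, ‖z‖ = 1) ∧ ∃ P : ℕ → ℂ[X], (∀ n, IsMonicOrthogonal μ n (P n)) ∧
    ∀ n, P (n + 1) = X * P n - C (conj (α n)) * reversed n (P n)

/-- `f` is the sequence of orthonormal polynomials of `μ`, i.e. what the Gram-Schmidt procedure in
`L²(μ)` makes of `1, z, z ^ 2, …`: orthonormal, with `f n` of degree `n` and with positive leading
coefficient. -/
structure IsOrthonormalPolynomials (μ : Measure ℂ) (f : ℕ → ℂ[X]) : Prop where
  natDegree_eq : ∀ n, (f n).natDegree = n
  leadingCoeff_pos : ∀ n, ∃ c : ℝ, 0 < c ∧ (f n).leadingCoeff = (c : ℂ)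
  orthonormal : ∀ m n, ∫ z : ℂ, conj ((f m).eval z) * (f n).eval z ∂μ =
    if m = n then 1 else 0

/-- The block `Θ_k = [[conj α_k, ρ_k], [ρ_k, -α_k]]`. -/
def Theta (α : ℕ → ℂ) (k : ℕ) : Matrix (Fin 2) (Fin 2) ℂ :=
  !![conj (α k), (rho α k : ℂ); (rho α k : ℂ), -α k]

/-- The upper left `n × n` corner of `diag(Θ_0, Θ_2, Θ_4, …)`. Rows and columns are numbered from
`0`, and the block `Θ_{2b}` occupies the rows and columns `2b` and `2b + 1`. If `|α_{n-1}| = 1`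
and `n` is odd, then the last block is the `1 × 1` block `[conj α_{n-1}]`. -/
def cmvL (α : ℕ → ℂ) (n : ℕ) : Matrix (Fin n) (Fin n) ℂ :=
  Matrix.of fun i j =>
    if (i : ℕ) / 2 = (j : ℕ) / 2 then
      Theta α (2 * ((i : ℕ) / 2)) (Fin.ofNat 2 (i : ℕ)) (Fin.ofNat 2 (j : ℕ))
    else 0

/-- The upper left `n × n` corner of `diag(Θ_{-1}, Θ_1, Θ_3, …)` with `Θ_{-1} = [1]`. The block
`Θ_{2b-1}`, for `b ≥ 1`, occupies the rows and columns `2b - 1` and `2b`. If `|α_{n-1}| = 1` and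
`n` is even, then the last block is the `1 × 1` block `[conj α_{n-1}]`. -/
def cmvM (α : ℕ → ℂ) (n : ℕ) : Matrix (Fin n) (Fin n) ℂ :=
  Matrix.of fun i j =>
    if ((i : ℕ) + 1) / 2 = ((j : ℕ) + 1) / 2 then
      if ((i : ℕ) + 1) / 2 = 0 then 1
      else Theta α (2 * (((i : ℕ) + 1) / 2) - 1) (Fin.ofNat 2 ((i : ℕ) + 1))
        (Fin.ofNat 2 ((j : ℕ) + 1))
    else 0

/-- The finite `n × n` CMV matrix `𝓛𝓜` with Verblunsky coefficients `α_0, …, α_{n-1}`, where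
`|α_k| < 1` for `k < n - 1` and `|α_{n-1}| = 1`. -/
def cmv (α : ℕ → ℂ) (n : ℕ) : Matrix (Fin n) (Fin n) ℂ := cmvL α n * cmvM α n

/-- The spectral measure of a normal matrix `A` and a vector `v`: the sum over the eigenvalues
`l` of `A` of the point masses at `l` of weight `‖E_l v‖ ^ 2`, with `E_l` the orthogonal projection
onto the eigenspace of `l`. -/
def spectralMeasure {n : ℕ} (A : Matrix (Fin n) (Fin n) ℂ) (v : EuclideanSpace ℂ (Fin n)) :
    Measure ℂ :=
  Measure.sum fun l : Module.End.Eigenvalues (Matrix.toEuclideanLin A) =>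
    ENNReal.ofReal
      (‖(Module.End.eigenspace (Matrix.toEuclideanLin A) (l : ℂ)).starProjection v‖ ^ 2) •
      Measure.dirac (l : ℂ)

/-- The positions of the Dirichlet data of the `p`-periodic coefficients `α`: the zeros of
`Φ_p - Φ_p^*`. -/
def dirichletData (α : ℕ → ℂ) (p : ℕ) : Finset ℂ :=
  (Phi α p - reversed p (Phi α p)).roots.toFinset

/-- The coefficients `α` with the one of index `p - 1` replaced by
`(1 + α_{p-1}) / (1 + conj α_{p-1})`. -/
def modified (α : ℕ → ℂ) (p : ℕ) : ℕ → ℂ :=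
  Function.update α (p - 1) ((1 + α (p - 1)) / (1 + conj (α (p - 1))))

/-- `w(z) = [d/dr |φ_p(r z)|^2 at r = 1, minus p |φ_p(z)|^2]⁻¹`. -/
def weight (α : ℕ → ℂ) (p : ℕ) (z : ℂ) : ℝ :=
  (deriv (fun r : ℝ => ‖(phi α p).eval ((r : ℂ) * z)‖ ^ 2) 1 - p * ‖(phi α p).eval z‖ ^ 2)⁻¹

end

end OPUC

/-!
Write `a_n = φ_n(z)` and `b_n = φ_n^*(z)`. The Szegő recurrence reads
`ρ_n a_{n+1} = z a_n - conj α_n b_n`, `ρ_n b_{n+1} = b_n - α_n z a_n`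
(`rho_mul_eval_phi_succ`, `rho_mul_eval_phiStar_succ`), and it yields the diagonal
Christoffel–Darboux formula `|b_n|² - |a_n|² = (1 - |z|²) K_n(z)` with
`K_n = ∑_{j<n} |φ_j|² > 0` (`christoffel_darboux`).

The formula locates the zeros of `Φ_p - Φ_p^*` on the unit circle. Differentiated along the radius
at a point of the circle, where `φ_p^*(z) = z ^ p conj (φ_p(1 / conj z))` expresses the derivative
of `|φ_p^*|²` through that of `|φ_p|²`, it shows that the weight is `1 / K_p(z)` (`weight_eq`);
it also excludes double zeros, at which the two radial derivatives would agree
(`card_dirichletData`).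

For `|α_k| ≤ 1` the blocks `Θ_k` are symmetric and unitary, hence so are `𝓛` and `𝓜`. With
`y = 1 / z` the recurrence says that `𝓜` maps `v = (a_0, y b_1, y a_2, y² b_3, …)` to
`u = (b_0, a_1, y b_2, y a_3, …)` and that `𝓛 u = z v`. Only the last row of `𝓜` imposes a
condition, `z a_{p-1} = conj (α̃_{p-1}) b_{p-1}`, which holds at the zeros of `Φ_p - Φ_p^*`
(`cmv_mulVec_cmvVec`). These `p` distinct eigenvalues exhaust the spectrum and the eigenspaces are
the lines through the vectors `v`. Since `v` has first component `1` and `‖v‖² = K_p(z)`,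
the spectral measure has mass `1 / K_p(z)` at `z` (`spectralMeasure_cmv_modified`).

If a probability measure has the Verblunsky coefficients `α`, then its monic orthogonal polynomials
are the `Φ_n` by induction, and orthonormality of the `φ_n` reduces to
`‖Φ_{n+1}‖² = ρ_n² ‖Φ_n‖²` (`HasVerblunskyCoeffs.integral_Phi_self`).
-/

namespace OPUC

open scoped Matrix

/-! ### Reversed polynomials and the Szegő recurrence -/

theorem coeff_reversed (k : ℕ) (P : ℂ[X]) (i : ℕ) :
    (reversed k P).coeff i = conj (P.coeff (revAt k i)) := by
  simp [reversed, coeff_reflect]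

theorem reversed_sub (k : ℕ) (P Q : ℂ[X]) :
    reversed k (P - Q) = reversed k P - reversed k Q := by
  simp [reversed, reflect_sub]

theorem reversed_C_mul (k : ℕ) (c : ℂ) (P : ℂ[X]) :
    reversed k (C c * P) = C (conj c) * reversed k P := by
  simp [reversed, reflect_C_mul]

theorem reversed_reversed (k : ℕ) (P : ℂ[X]) : reversed k (reversed k P) = P := by
  ext i; simp [coeff_reversed]

theorem natDegree_reversed_le {k : ℕ} {P : ℂ[X]} (h : P.natDegree ≤ k) :
    (reversed k P).natDegree ≤ k := by
  refine natDegree_le_iff_coeff_eq_zero.2 fun i hi => ?_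
  rw [coeff_reversed, revAt_eq_self_of_lt hi,
    coeff_eq_zero_of_natDegree_lt (h.trans_lt hi), map_zero]

theorem natDegree_X_mul_le_succ {k : ℕ} {P : ℂ[X]} (h : P.natDegree ≤ k) :
    (X * P).natDegree ≤ k + 1 :=
  natDegree_mul_le.trans (by rw [natDegree_X]; omega)

theorem reversed_succ_X_mul {k : ℕ} {P : ℂ[X]} (h : P.natDegree ≤ k) :
    reversed (k + 1) (X * P) = reversed k P := by
  ext i
  rw [coeff_reversed, coeff_reversed]
  rcases lt_trichotomy i (k + 1) with hi | rfl | hi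
  · rw [revAt_le hi.le, revAt_le (Nat.lt_succ_iff.1 hi), Nat.succ_sub (Nat.lt_succ_iff.1 hi),
      coeff_X_mul]
  · rw [revAt_le le_rfl, revAt_eq_self_of_lt (Nat.lt_succ_self k),
      coeff_eq_zero_of_natDegree_lt (h.trans_lt (Nat.lt_succ_self k))]
    simp
  · rw [revAt_eq_self_of_lt hi, revAt_eq_self_of_lt (by omega),
      coeff_eq_zero_of_natDegree_lt (n := i) (p := P) (by omega),
      coeff_eq_zero_of_natDegree_lt ((natDegree_X_mul_le_succ h).trans_lt hi)]

theorem reversed_succ_reversed {k : ℕ} {P : ℂ[X]} (h : P.natDegree ≤ k) :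
    reversed (k + 1) (reversed k P) = X * P := by
  rw [← reversed_succ_X_mul h, reversed_reversed]

theorem natDegree_Phi_le (α : ℕ → ℂ) (n : ℕ) : (Phi α n).natDegree ≤ n := by
  induction n with
  | zero => simp [Phi]
  | succ n ih =>
    rw [Phi]
    refine (natDegree_sub_le _ _).trans (max_le ?_ ?_)
    · exact natDegree_X_mul_le_succ ih
    · exact (natDegree_C_mul_le _ _).trans ((natDegree_reversed_le ih).trans n.le_succ)

theorem coeff_Phi_self (α : ℕ → ℂ) (n : ℕ) : (Phi α n).coeff n = 1 := by
  induction n with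
  | zero => simp [Phi]
  | succ n ih =>
    rw [Phi, coeff_sub, coeff_X_mul, ih, coeff_C_mul, coeff_eq_zero_of_natDegree_lt
      ((natDegree_reversed_le (natDegree_Phi_le α n)).trans_lt n.lt_succ_self)]
    simp

theorem monic_Phi (α : ℕ → ℂ) (n : ℕ) : (Phi α n).Monic :=
  monic_of_natDegree_le_of_coeff_eq_one n (natDegree_Phi_le α n) (coeff_Phi_self α n)

theorem natDegree_Phi (α : ℕ → ℂ) (n : ℕ) : (Phi α n).natDegree = n :=
  natDegree_eq_of_le_of_coeff_ne_zero (natDegree_Phi_le α n) (by simp [coeff_Phi_self])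

theorem reversed_Phi_succ (α : ℕ → ℂ) (n : ℕ) :
    reversed (n + 1) (Phi α (n + 1)) = reversed n (Phi α n) - C (α n) * (X * Phi α n) := by
  rw [Phi, reversed_sub, reversed_C_mul, reversed_succ_X_mul (natDegree_Phi_le α n),
    reversed_succ_reversed (natDegree_Phi_le α n)]
  simp

/-- The form `P^*(w) = w ^ n conj (P(1 / conj w))` of the reversed polynomial, for `P = Φ_n`. -/
theorem eval_reversed_Phi (α : ℕ → ℂ) (n : ℕ) {w : ℂ} (hw : w ≠ 0) :
    (reversed n (Phi α n)).eval w = w ^ n * conj ((Phi α n).eval (conj w)⁻¹) := by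
  induction n generalizing w with
  | zero => simp [Phi, reversed, reflect_one]
  | succ n ih =>
    have hw' : conj w ≠ 0 := by simpa using hw
    have h := ih (w := (conj w)⁻¹) (by simpa using hw)
    rw [reversed_Phi_succ, Phi]
    simp only [eval_sub, eval_mul, eval_C, eval_X, map_sub, map_mul, h, ih hw, map_pow,
      map_inv₀, Complex.conj_conj, inv_inv, inv_pow, pow_succ]
    field_simp

/-- The reversed orthonormal polynomial `φ_n^*`. -/
noncomputable def phiStar (α : ℕ → ℂ) (n : ℕ) : ℂ[X] := reversed n (phi α n)

theorem phiStar_eq (α : ℕ → ℂ) (n : ℕ) :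
    phiStar α n = C ((∏ j ∈ Finset.range n, (rho α j : ℂ))⁻¹) * reversed n (Phi α n) := by
  rw [phiStar, phi, reversed_C_mul]
  simp [map_prod]

theorem eval_phi (α : ℕ → ℂ) (n : ℕ) (z : ℂ) :
    (phi α n).eval z = (∏ j ∈ Finset.range n, (rho α j : ℂ))⁻¹ * (Phi α n).eval z := by
  rw [phi, eval_mul, eval_C]

theorem phi_zero (α : ℕ → ℂ) : phi α 0 = 1 := by simp [phi, Phi]

theorem phiStar_zero (α : ℕ → ℂ) : phiStar α 0 = 1 := by
  simp [phiStar_eq, Phi, reversed, reflect_one]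

theorem rho_sq {α : ℕ → ℂ} {n : ℕ} (h : ‖α n‖ ≤ 1) : rho α n ^ 2 = 1 - ‖α n‖ ^ 2 :=
  Real.sq_sqrt (by nlinarith [norm_nonneg (α n)])

theorem rho_sq_complex {α : ℕ → ℂ} {n : ℕ} (h : ‖α n‖ ≤ 1) :
    (rho α n : ℂ) ^ 2 = 1 - α n * conj (α n) := by
  rw [← Complex.ofReal_pow, rho_sq h, Complex.mul_conj, Complex.normSq_eq_norm_sq]
  push_cast; rfl

theorem rho_pos {α : ℕ → ℂ} {n : ℕ} (h : ‖α n‖ < 1) : 0 < rho α n :=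
  Real.sqrt_pos.2 (by nlinarith [norm_nonneg (α n)])

theorem rho_mul_eval_phi_succ {α : ℕ → ℂ} {n : ℕ} (h : ‖α n‖ < 1) (z : ℂ) :
    (rho α n : ℂ) * (phi α (n + 1)).eval z =
      z * (phi α n).eval z - conj (α n) * (phiStar α n).eval z := by
  have h0 : (rho α n : ℂ) ≠ 0 := by exact_mod_cast (rho_pos h).ne'
  rw [phi, phi, phiStar_eq, Finset.prod_range_succ, Phi, mul_inv]
  simp only [eval_mul, eval_sub, eval_C, eval_X]
  field_simp

theorem rho_mul_eval_phiStar_succ {α : ℕ → ℂ} {n : ℕ} (h : ‖α n‖ < 1) (z : ℂ) :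
    (rho α n : ℂ) * (phiStar α (n + 1)).eval z =
      (phiStar α n).eval z - α n * (z * (phi α n).eval z) := by
  have h0 : (rho α n : ℂ) ≠ 0 := by exact_mod_cast (rho_pos h).ne'
  rw [phi, phiStar_eq, phiStar_eq, Finset.prod_range_succ, reversed_Phi_succ, mul_inv]
  simp only [eval_mul, eval_sub, eval_C, eval_X]
  field_simp

theorem eval_phiStar (α : ℕ → ℂ) (n : ℕ) {w : ℂ} (hw : w ≠ 0) :
    (phiStar α n).eval w = w ^ n * conj ((phi α n).eval (conj w)⁻¹) := by
  rw [phiStar_eq, phi]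
  simp only [eval_mul, eval_C, eval_reversed_Phi α n hw, map_mul, map_inv₀, map_prod,
    Complex.conj_ofReal]
  ring

theorem norm_eval_phiStar_of_norm_eq_one (α : ℕ → ℂ) (n : ℕ) {z : ℂ} (hz : ‖z‖ = 1) :
    ‖(phiStar α n).eval z‖ = ‖(phi α n).eval z‖ := by
  have h0 : z ≠ 0 := by rintro rfl; simp at hz
  rw [eval_phiStar α n h0, Complex.inv_eq_conj (by simpa using hz)]
  simp [hz]

/-! ### The Christoffel–Darboux formula on the diagonal -/

/-- One step of the Szegő recurrence preserves the form `|b|² - |a|²`, up to the factor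
`1 - |α|² = ρ²`, after `a` is replaced by `z a`. -/
theorem norm_sq_sub_norm_sq_step {a b z α : ℂ} :
    ‖b - α * (z * a)‖ ^ 2 - ‖z * a - conj α * b‖ ^ 2 =
      (1 - ‖α‖ ^ 2) * (‖b‖ ^ 2 - ‖z‖ ^ 2 * ‖a‖ ^ 2) := by
  rw [← mul_pow, ← norm_mul]
  simp only [← Complex.normSq_eq_norm_sq, Complex.normSq_apply]
  simp
  ring

/-- The Christoffel–Darboux kernel `∑_{j<n} |φ_j(z)|²` on the diagonal. -/
noncomputable def kernel (α : ℕ → ℂ) (n : ℕ) (z : ℂ) : ℝ :=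
  ∑ j ∈ Finset.range n, ‖(phi α j).eval z‖ ^ 2

theorem kernel_pos (α : ℕ → ℂ) {n : ℕ} (hn : 0 < n) (z : ℂ) : 0 < kernel α n z := by
  refine lt_of_lt_of_le ?_ (Finset.single_le_sum (f := fun j => ‖(phi α j).eval z‖ ^ 2)
    (fun j _ => by positivity) (Finset.mem_range.2 hn))
  simp [phi_zero]

theorem christoffel_darboux {α : ℕ → ℂ} (hα : ∀ j, ‖α j‖ < 1) (n : ℕ) (z : ℂ) :
    ‖(phiStar α n).eval z‖ ^ 2 - ‖(phi α n).eval z‖ ^ 2 = (1 - ‖z‖ ^ 2) * kernel α n z := by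
  induction n with
  | zero => simp [phi_zero, phiStar_zero, kernel]
  | succ n ih =>
    have hρ := rho_pos (hα n)
    have h := norm_sq_sub_norm_sq_step (a := (phi α n).eval z) (b := (phiStar α n).eval z)
      (z := z) (α := α n)
    rw [← rho_mul_eval_phi_succ (hα n), ← rho_mul_eval_phiStar_succ (hα n),
      ← rho_sq (hα n).le, norm_mul, norm_mul, mul_pow, mul_pow, Complex.norm_real,
      Real.norm_of_nonneg hρ.le, ← mul_sub] at h
    have h' := mul_left_cancel₀ (by positivity) h
    rw [kernel] at ih ⊢
    rw [h', Finset.sum_range_succ]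
    linear_combination ih

theorem hasDerivAt_norm_sq_eval_radial (P : ℂ[X]) (z : ℂ) :
    HasDerivAt (fun r : ℝ => ‖P.eval ((r : ℂ) * z)‖ ^ 2)
      (2 * inner ℝ (P.eval z) (P.derivative.eval z * z)) 1 := by
  have h1 : HasDerivAt (fun r : ℝ => (r : ℂ) * z) z 1 := by
    simpa using (Complex.ofRealCLM.hasDerivAt (x := (1 : ℝ))).mul_const z
  have h2 := (P.hasDerivAt (((1 : ℝ) : ℂ) * z)).comp (1 : ℝ) h1
  simpa using h2.norm_sq

theorem hasDerivAt_christoffel_darboux {α : ℕ → ℂ} (hα : ∀ j, ‖α j‖ < 1) (n : ℕ) {z : ℂ}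
    (hz : ‖z‖ = 1) :
    HasDerivAt (fun r : ℝ => ‖(phiStar α n).eval ((r : ℂ) * z)‖ ^ 2 -
      ‖(phi α n).eval ((r : ℂ) * z)‖ ^ 2) (-2 * kernel α n z) 1 := by
  have hk : DifferentiableAt ℝ (fun r : ℝ => kernel α n ((r : ℂ) * z)) 1 := by
    unfold kernel
    exact DifferentiableAt.fun_sum fun j _ =>
      (hasDerivAt_norm_sq_eval_radial (phi α j) z).differentiableAt
  have h1 : HasDerivAt (fun r : ℝ => 1 - r ^ 2) (-2) 1 := by
    simpa using ((hasDerivAt_pow 2 (1 : ℝ)).const_sub 1)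
  have h := h1.mul hk.hasDerivAt
  refine (h.congr_deriv (by simp)).congr_of_eventuallyEq (Filter.Eventually.of_forall fun r => ?_)
  simp [christoffel_darboux hα, hz]

/-- On a ray `|φ_n^*(r z)|² = r ^ (2 n) |φ_n(z / r)|²`, and the inversion of `r` turns the sign of the
radial derivative of `|φ_n|²`. -/
theorem hasDerivAt_norm_sq_phiStar_radial (α : ℕ → ℂ) (n : ℕ) {z : ℂ} (hz : ‖z‖ = 1) :
    HasDerivAt (fun r : ℝ => ‖(phiStar α n).eval ((r : ℂ) * z)‖ ^ 2)
      (2 * n * ‖(phi α n).eval z‖ ^ 2 -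
        deriv (fun r : ℝ => ‖(phi α n).eval ((r : ℂ) * z)‖ ^ 2) 1) 1 := by
  have h0 : z ≠ 0 := by rintro rfl; simp at hz
  have hd := (hasDerivAt_norm_sq_eval_radial (phi α n) z).differentiableAt.hasDerivAt
  have hinv : HasDerivAt (fun r : ℝ => r⁻¹) (-1) 1 := by
    simpa using hasDerivAt_inv (one_ne_zero (α := ℝ))
  rw [← inv_one (G := ℝ)] at hd
  have hc := (hasDerivAt_pow (2 * n) (1 : ℝ)).mul (HasDerivAt.comp (1 : ℝ) hd hinv)
  rw [inv_one] at hc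
  have he : (fun r : ℝ => ‖(phiStar α n).eval ((r : ℂ) * z)‖ ^ 2) =ᶠ[nhds 1]
      fun r : ℝ => r ^ (2 * n) * ‖(phi α n).eval (((r⁻¹ : ℝ) : ℂ) * z)‖ ^ 2 := by
    filter_upwards [lt_mem_nhds (zero_lt_one (α := ℝ))] with r hr
    have hr0 : (r : ℂ) ≠ 0 := by exact_mod_cast hr.ne'
    rw [eval_phiStar α n (mul_ne_zero hr0 h0), map_mul, Complex.conj_ofReal, mul_inv,
      Complex.inv_eq_conj (z := conj z) (by simpa using hz)]
    simp only [norm_mul, norm_pow, hz, Complex.norm_real, Real.norm_of_nonneg hr.le,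
      Complex.conj_conj, RCLike.norm_conj, Complex.ofReal_inv]
    ring
  refine (hc.congr_of_eventuallyEq he).congr_deriv ?_
  simp
  ring

/-- On the unit circle the weight is the Christoffel function. -/
theorem weight_eq {α : ℕ → ℂ} (hα : ∀ j, ‖α j‖ < 1) (n : ℕ) {z : ℂ} (hz : ‖z‖ = 1) :
    weight α n z = (kernel α n z)⁻¹ := by
  have h1 := hasDerivAt_norm_sq_phiStar_radial α n hz
  have h2 := (hasDerivAt_norm_sq_eval_radial (phi α n) z).differentiableAt.hasDerivAt
  have h := (h1.sub h2).unique (hasDerivAt_christoffel_darboux hα n hz)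
  rw [weight]
  congr 1
  linarith

/-! ### The Dirichlet data -/

theorem eval_Phi_eq_iff {α : ℕ → ℂ} (hα : ∀ j, ‖α j‖ < 1) (n : ℕ) (z : ℂ) :
    (Phi α n).eval z = (reversed n (Phi α n)).eval z ↔
      (phi α n).eval z = (phiStar α n).eval z := by
  have h : (∏ j ∈ Finset.range n, (rho α j : ℂ))⁻¹ ≠ 0 :=
    inv_ne_zero (Finset.prod_ne_zero_iff.2 fun j _ => by exact_mod_cast (rho_pos (hα j)).ne')
  rw [phi, phiStar_eq, eval_mul, eval_mul, eval_C, mul_right_inj' h]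

theorem norm_eq_one_of_eval_phi_eq {α : ℕ → ℂ} (hα : ∀ j, ‖α j‖ < 1) {n : ℕ} (hn : 0 < n)
    {z : ℂ} (h : (phi α n).eval z = (phiStar α n).eval z) : ‖z‖ = 1 := by
  have hcd := christoffel_darboux hα n z
  rw [h, sub_self, eq_comm, mul_eq_zero] at hcd
  have := hcd.resolve_right (kernel_pos α hn z).ne'
  nlinarith [norm_nonneg z]

theorem one_add_ne_zero_of_norm_lt {a : ℂ} (h : ‖a‖ < 1) : 1 + a ≠ 0 := by
  intro h0
  rw [← neg_eq_of_add_eq_zero_right h0] at h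
  simp at h

theorem natDegree_Phi_sub_reversed {α : ℕ → ℂ} (hα : ∀ j, ‖α j‖ < 1) {n : ℕ} (hn : 0 < n) :
    (Phi α n - reversed n (Phi α n)).natDegree = n := by
  obtain ⟨m, rfl⟩ := Nat.exists_eq_succ_of_ne_zero hn.ne'
  refine natDegree_eq_of_le_of_coeff_ne_zero ((natDegree_sub_le _ _).trans
    (max_le (natDegree_Phi_le _ _) (natDegree_reversed_le (natDegree_Phi_le _ _)))) ?_
  rw [coeff_sub, coeff_Phi_self, reversed_Phi_succ, coeff_sub, coeff_C_mul, coeff_X_mul,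
    coeff_Phi_self, coeff_eq_zero_of_natDegree_lt
      ((natDegree_reversed_le (natDegree_Phi_le α m)).trans_lt m.lt_succ_self)]
  simpa using one_add_ne_zero_of_norm_lt (hα m)

theorem Phi_sub_reversed_ne_zero {α : ℕ → ℂ} (hα : ∀ j, ‖α j‖ < 1) {n : ℕ} (hn : 0 < n) :
    Phi α n - reversed n (Phi α n) ≠ 0 :=
  ne_zero_of_natDegree_gt (n := 0) (by rw [natDegree_Phi_sub_reversed hα hn]; exact hn)

theorem mem_dirichletData {α : ℕ → ℂ} (hα : ∀ j, ‖α j‖ < 1) {n : ℕ} (hn : 0 < n) {z : ℂ} :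
    z ∈ dirichletData α n ↔ (phi α n).eval z = (phiStar α n).eval z := by
  rw [dirichletData, Multiset.mem_toFinset, mem_roots (Phi_sub_reversed_ne_zero hα hn),
    IsRoot.def, eval_sub, sub_eq_zero, eval_Phi_eq_iff hα]

/-- The zeros of `Φ_n - Φ_n^*` are simple: at a double zero `|φ_n|²` and `|φ_n^*|²` would have
the same radial derivative, but the derivatives differ by twice the Christoffel–Darboux kernel. -/
theorem card_dirichletData {α : ℕ → ℂ} (hα : ∀ j, ‖α j‖ < 1) {n : ℕ} (hn : 0 < n) :
    (dirichletData α n).card = n := by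
  set F := Phi α n - reversed n (Phi α n) with hF
  have hF0 : F ≠ 0 := Phi_sub_reversed_ne_zero hα hn
  have hnodup : F.roots.Nodup := by
    refine Multiset.nodup_iff_count_le_one.2 fun z => ?_
    rw [count_roots]
    by_contra! h
    obtain ⟨h0, h1⟩ := (one_lt_rootMultiplicity_iff_isRoot hF0).1 h
    rw [hF, IsRoot.def, eval_sub, sub_eq_zero] at h0
    rw [hF, IsRoot.def, derivative_sub, eval_sub, sub_eq_zero] at h1
    have e0 := (eval_Phi_eq_iff hα n z).1 h0
    have e1 : (phi α n).derivative.eval z = (phiStar α n).derivative.eval z := by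
      rw [phi, phiStar_eq, derivative_C_mul, derivative_C_mul, eval_mul, eval_mul, h1]
    have hd := (hasDerivAt_norm_sq_eval_radial (phiStar α n) z).sub
      (hasDerivAt_norm_sq_eval_radial (phi α n) z)
    rw [e0, e1, sub_self] at hd
    have hk := hd.unique
      (hasDerivAt_christoffel_darboux hα n (norm_eq_one_of_eval_phi_eq hα hn e0))
    linarith [kernel_pos α hn z]
  rw [dirichletData, ← hF, Multiset.toFinset_card_of_nodup hnodup,
    splits_iff_card_roots.1 (IsAlgClosed.splits F), hF, natDegree_Phi_sub_reversed hα hn]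

/-! ### Orthonormality -/

theorem integrable_conj_eval_mul_eval {μ : Measure ℂ} [IsFiniteMeasure μ]
    (hμ : ∀ᵐ z ∂μ, ‖z‖ = 1) (P Q : ℂ[X]) :
    Integrable (fun z => conj (P.eval z) * Q.eval z) μ := by
  have hc : Continuous fun z : ℂ => conj (P.eval z) * Q.eval z :=
    (Complex.continuous_conj.comp P.continuous).mul Q.continuous
  obtain ⟨C, hC⟩ := (isCompact_sphere (0 : ℂ) 1).exists_bound_of_continuousOn hc.continuousOn
  exact Integrable.of_bound hc.aestronglyMeasurable C
    (hμ.mono fun z hz => hC z (by simpa using hz))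

theorem integral_conj_eval_mul_eval_swap (μ : Measure ℂ) (P Q : ℂ[X]) :
    ∫ z, conj (P.eval z) * Q.eval z ∂μ = conj (∫ z, conj (Q.eval z) * P.eval z ∂μ) := by
  rw [← integral_conj]
  simp [mul_comm]

theorem HasVerblunskyCoeffs.isMonicOrthogonal_Phi {μ : Measure ℂ} {α : ℕ → ℂ}
    (h : HasVerblunskyCoeffs μ α) (n : ℕ) : IsMonicOrthogonal μ n (Phi α n) := by
  obtain ⟨-, P, hP, hrec⟩ := h
  have : P = Phi α := by
    funext n
    induction n with
    | zero => exact (hP 0).monic.natDegree_eq_zero.1 (hP 0).natDegree_eq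
    | succ n ih => rw [hrec, ih, Phi]
  exact this ▸ hP n

/-- `‖Φ_{n+1}‖² = ρ_n² ‖Φ_n‖²`, because `Φ_{n+1}` is orthogonal to `Φ_n^*`, which has degree at
most `n` and the same absolute value as `Φ_n` on the unit circle. -/
theorem HasVerblunskyCoeffs.integral_Phi_self {μ : Measure ℂ} [IsProbabilityMeasure μ]
    {α : ℕ → ℂ} (hα : ∀ j, ‖α j‖ < 1) (h : HasVerblunskyCoeffs μ α) (n : ℕ) :
    ∫ z, conj ((Phi α n).eval z) * (Phi α n).eval z ∂μ =
      ∏ j ∈ Finset.range n, (rho α j : ℂ) ^ 2 := by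
  induction n with
  | zero => simp [Phi]
  | succ n ih =>
    have hint := fun P Q => integrable_conj_eval_mul_eval (μ := μ) h.1 P Q
    set A := Phi α (n + 1) with hA
    set B := reversed n (Phi α n) with hB
    have hBA : ∫ z, conj (B.eval z) * A.eval z ∂μ = 0 := by
      refine (h.isMonicOrthogonal_Phi (n + 1)).orthogonal B ?_
      refine (degree_le_of_natDegree_le (natDegree_reversed_le (natDegree_Phi_le α n))).trans_lt ?_
      exact_mod_cast n.lt_succ_self
    have hAB : ∫ z, conj (A.eval z) * B.eval z ∂μ = 0 := by
      rw [integral_conj_eval_mul_eval_swap, hBA, map_zero]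
    have hpt : ∀ᵐ z ∂μ, conj (A.eval z) * A.eval z + conj (α n) * (conj (A.eval z) * B.eval z) +
        α n * (conj (B.eval z) * A.eval z) =
        (rho α n : ℂ) ^ 2 * (conj ((Phi α n).eval z) * (Phi α n).eval z) := by
      filter_upwards [h.1] with z hz
      have h0 : z ≠ 0 := by rintro rfl; simp at hz
      have hzz : z * conj z = 1 := by
        rw [← Complex.inv_eq_conj hz, mul_inv_cancel₀ h0]
      have hBz : B.eval z * conj (B.eval z) = conj ((Phi α n).eval z) * (Phi α n).eval z := by
        rw [hB, eval_reversed_Phi α n h0, Complex.inv_eq_conj (by simpa using hz)]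
        simp only [map_mul, map_pow, Complex.conj_conj]
        rw [mul_mul_mul_comm, ← mul_pow, hzz, one_pow, one_mul]
      rw [rho_sq_complex (hα n).le, hA, Phi, ← hB]
      simp only [eval_sub, eval_mul, eval_C, eval_X, map_sub, map_mul, Complex.conj_conj]
      linear_combination (conj ((Phi α n).eval z) * (Phi α n).eval z) * hzz -
        α n * conj (α n) * hBz
    have hI := integral_congr_ae hpt
    rw [integral_add ((hint A A).fun_add ((hint A B).const_mul _)) ((hint B A).const_mul _),
      integral_add (hint A A) ((hint A B).const_mul _)] at hI
    simp only [integral_const_mul, hAB, hBA, ih, mul_zero, add_zero] at hI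
    rw [hI, Finset.prod_range_succ, mul_comm]

theorem HasVerblunskyCoeffs.isOrthonormalPolynomials_phi {μ : Measure ℂ}
    [IsProbabilityMeasure μ] {α : ℕ → ℂ} (hα : ∀ j, ‖α j‖ < 1) (h : HasVerblunskyCoeffs μ α) :
    IsOrthonormalPolynomials μ (phi α) := by
  have hprod : ∀ n, (0 : ℝ) < ∏ j ∈ Finset.range n, rho α j := fun n =>
    Finset.prod_pos fun j _ => rho_pos (hα j)
  have hc : ∀ n, (∏ j ∈ Finset.range n, (rho α j : ℂ))⁻¹ ≠ 0 := fun n =>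
    inv_ne_zero (by rw [← Complex.ofReal_prod]; exact_mod_cast (hprod n).ne')
  have hlt : ∀ m n, m < n → ∫ z, conj ((phi α m).eval z) * (phi α n).eval z ∂μ = 0 := by
    intro m n hmn
    have hq : (phi α m).degree < n := by
      rw [phi, degree_C_mul (hc m)]
      exact (degree_le_of_natDegree_le (natDegree_Phi_le α m)).trans_lt (by exact_mod_cast hmn)
    have := (h.isMonicOrthogonal_Phi n).orthogonal _ hq
    simp only [eval_phi α n, mul_left_comm _ (∏ j ∈ Finset.range n, (rho α j : ℂ))⁻¹]
    rw [integral_const_mul, this, mul_zero]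
  refine ⟨fun n => ?_, fun n => ⟨(∏ j ∈ Finset.range n, rho α j)⁻¹, inv_pos.2 (hprod n), ?_⟩,
    fun m n => ?_⟩
  · rw [phi, natDegree_C_mul (hc n), natDegree_Phi]
  · rw [phi, leadingCoeff_mul, leadingCoeff_C, (monic_Phi α n).leadingCoeff]
    simp
  · rcases lt_trichotomy m n with hmn | rfl | hmn
    · rw [if_neg hmn.ne, hlt m n hmn]
    · rw [if_pos rfl]
      have h1 := h.integral_Phi_self hα m
      have h2 := hc m
      have h3 : ∀ z, conj ((phi α m).eval z) * (phi α m).eval z =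
          (∏ j ∈ Finset.range m, (rho α j : ℂ))⁻¹ * (∏ j ∈ Finset.range m, (rho α j : ℂ))⁻¹ *
            (conj ((Phi α m).eval z) * (Phi α m).eval z) := fun z => by
        rw [eval_phi, map_mul, map_inv₀, map_prod, mul_mul_mul_comm]
        simp only [Complex.conj_ofReal]
      simp only [h3]
      rw [integral_const_mul, h1, Finset.prod_pow, sq, mul_mul_mul_comm,
        inv_mul_cancel₀ fun h => h2 (by rw [h, inv_zero]), one_mul]
    · rw [if_neg hmn.ne', integral_conj_eval_mul_eval_swap, hlt n m hmn, map_zero]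

/-! ### The factors of the CMV matrix -/

theorem sum_eq_of_support_pair {n : ℕ} {M : Type*} [AddCommMonoid M] {i j : Fin n} (hij : i ≠ j)
    (f : Fin n → M) (h : ∀ k, k ≠ i → k ≠ j → f k = 0) : ∑ k, f k = f i + f j :=
  Finset.sum_eq_add i j hij (fun k _ hk => h k hk.1 hk.2) (by simp) (by simp)

theorem cmvL_mulVec_even {α : ℕ → ℂ} {n b : ℕ} (hb : 2 * b + 1 < n) (g : Fin n → ℂ) :
    (cmvL α n *ᵥ g) ⟨2 * b, by omega⟩ =
      conj (α (2 * b)) * g ⟨2 * b, by omega⟩ + rho α (2 * b) * g ⟨2 * b + 1, hb⟩ := by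
  simp only [Matrix.mulVec, dotProduct]
  rw [sum_eq_of_support_pair (i := ⟨2 * b, by omega⟩) (j := ⟨2 * b + 1, hb⟩)
    (by simp) _ fun k h1 h2 => ?_]
  · have e : 2 * b / 2 = b := by omega
    have e' : (2 * b + 1) / 2 = b := by omega
    have f : Fin.ofNat 2 (2 * b) = 0 := by ext; simp
    have f' : Fin.ofNat 2 (2 * b + 1) = 1 := by ext; simp
    simp only [cmvL, Matrix.of_apply, e, e', f, f', ↓reduceIte]
    simp [Theta]
  · have h1' : (k : ℕ) ≠ 2 * b := fun h => h1 (Fin.ext h)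
    have h2' : (k : ℕ) ≠ 2 * b + 1 := fun h => h2 (Fin.ext h)
    simp only [cmvL, Matrix.of_apply]
    rw [if_neg (by omega), zero_mul]

theorem cmvL_mulVec_odd {α : ℕ → ℂ} {n b : ℕ} (hb : 2 * b + 1 < n) (g : Fin n → ℂ) :
    (cmvL α n *ᵥ g) ⟨2 * b + 1, hb⟩ =
      rho α (2 * b) * g ⟨2 * b, by omega⟩ - α (2 * b) * g ⟨2 * b + 1, hb⟩ := by
  simp only [Matrix.mulVec, dotProduct]
  rw [sum_eq_of_support_pair (i := ⟨2 * b, by omega⟩) (j := ⟨2 * b + 1, hb⟩)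
    (by simp) _ fun k h1 h2 => ?_]
  · have e : 2 * b / 2 = b := by omega
    have e' : (2 * b + 1) / 2 = b := by omega
    have f : Fin.ofNat 2 (2 * b) = 0 := by ext; simp
    have f' : Fin.ofNat 2 (2 * b + 1) = 1 := by ext; simp
    simp only [cmvL, Matrix.of_apply, e, e', f, f', ↓reduceIte]
    simp [Theta, sub_eq_add_neg]
  · have h1' : (k : ℕ) ≠ 2 * b := fun h => h1 (Fin.ext h)
    have h2' : (k : ℕ) ≠ 2 * b + 1 := fun h => h2 (Fin.ext h)
    simp only [cmvL, Matrix.of_apply]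
    rw [if_neg (by omega), zero_mul]

theorem cmvM_mulVec_zero {α : ℕ → ℂ} {n : ℕ} (hn : 0 < n) (g : Fin n → ℂ) :
    (cmvM α n *ᵥ g) ⟨0, hn⟩ = g ⟨0, hn⟩ := by
  simp only [Matrix.mulVec, dotProduct]
  rw [Finset.sum_eq_single (⟨0, hn⟩ : Fin n) (fun k _ h => ?_) (by simp)]
  · simp [cmvM]
  · have h' : (k : ℕ) ≠ 0 := fun h0 => h (Fin.ext h0)
    simp only [cmvM, Matrix.of_apply]
    rw [if_neg (by omega), zero_mul]

theorem cmvM_mulVec_odd {α : ℕ → ℂ} {n b : ℕ} (hb : 2 * b + 2 < n) (g : Fin n → ℂ) :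
    (cmvM α n *ᵥ g) ⟨2 * b + 1, by omega⟩ =
      conj (α (2 * b + 1)) * g ⟨2 * b + 1, by omega⟩ + rho α (2 * b + 1) * g ⟨2 * b + 2, hb⟩ := by
  simp only [Matrix.mulVec, dotProduct]
  rw [sum_eq_of_support_pair (i := ⟨2 * b + 1, by omega⟩) (j := ⟨2 * b + 2, hb⟩)
    (by simp) _ fun k h1 h2 => ?_]
  · have e : (2 * b + 1 + 1) / 2 = b + 1 := by omega
    have e' : (2 * b + 2 + 1) / 2 = b + 1 := by omega
    have t : 2 * (b + 1) - 1 = 2 * b + 1 := by omega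
    have f : Fin.ofNat 2 (2 * b + 1 + 1) = 0 := by ext; simp; omega
    have f' : Fin.ofNat 2 (2 * b + 2 + 1) = 1 := by ext; simp; omega
    simp only [cmvM, Matrix.of_apply, e, e', f, f', t, ↓reduceIte, Nat.succ_ne_zero]
    simp [Theta]
  · have h1' : (k : ℕ) ≠ 2 * b + 1 := fun h => h1 (Fin.ext h)
    have h2' : (k : ℕ) ≠ 2 * b + 2 := fun h => h2 (Fin.ext h)
    simp only [cmvM, Matrix.of_apply]
    rw [if_neg (by omega), zero_mul]

theorem cmvM_mulVec_even {α : ℕ → ℂ} {n b : ℕ} (hb : 2 * b + 2 < n) (g : Fin n → ℂ) :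
    (cmvM α n *ᵥ g) ⟨2 * b + 2, hb⟩ =
      rho α (2 * b + 1) * g ⟨2 * b + 1, by omega⟩ - α (2 * b + 1) * g ⟨2 * b + 2, hb⟩ := by
  simp only [Matrix.mulVec, dotProduct]
  rw [sum_eq_of_support_pair (i := ⟨2 * b + 1, by omega⟩) (j := ⟨2 * b + 2, hb⟩)
    (by simp) _ fun k h1 h2 => ?_]
  · have e : (2 * b + 1 + 1) / 2 = b + 1 := by omega
    have e' : (2 * b + 2 + 1) / 2 = b + 1 := by omega
    have t : 2 * (b + 1) - 1 = 2 * b + 1 := by omega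
    have f : Fin.ofNat 2 (2 * b + 1 + 1) = 0 := by ext; simp; omega
    have f' : Fin.ofNat 2 (2 * b + 2 + 1) = 1 := by ext; simp; omega
    simp only [cmvM, Matrix.of_apply, e, e', f, f', t, ↓reduceIte, Nat.succ_ne_zero]
    simp [Theta, sub_eq_add_neg]
  · have h1' : (k : ℕ) ≠ 2 * b + 1 := fun h => h1 (Fin.ext h)
    have h2' : (k : ℕ) ≠ 2 * b + 2 := fun h => h2 (Fin.ext h)
    simp only [cmvM, Matrix.of_apply]
    rw [if_neg (by omega), zero_mul]

theorem cmvM_mulVec_last {α : ℕ → ℂ} {n b : ℕ} (hb : n = 2 * b + 2) (g : Fin n → ℂ) :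
    (cmvM α n *ᵥ g) ⟨2 * b + 1, by omega⟩ =
      conj (α (2 * b + 1)) * g ⟨2 * b + 1, by omega⟩ := by
  simp only [Matrix.mulVec, dotProduct]
  rw [Finset.sum_eq_single (⟨2 * b + 1, by omega⟩ : Fin n) (fun k _ h => ?_) (by simp)]
  · have e : (2 * b + 1 + 1) / 2 = b + 1 := by omega
    have t : 2 * (b + 1) - 1 = 2 * b + 1 := by omega
    have f : Fin.ofNat 2 (2 * b + 1 + 1) = 0 := by ext; simp; omega
    simp only [cmvM, Matrix.of_apply, e, f, t, ↓reduceIte, Nat.succ_ne_zero]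
    simp [Theta]
  · have h1' : (k : ℕ) ≠ 2 * b + 1 := fun h0 => h (Fin.ext h0)
    simp only [cmvM, Matrix.of_apply]
    rw [if_neg (by omega), zero_mul]

/-- Conjugating the coefficients gives the adjoint block, because `Θ_k` is symmetric and `ρ_k`
depends on `|α_k|` only. -/
theorem star_Theta (α : ℕ → ℂ) (k : ℕ) (r s : Fin 2) :
    conj (Theta α k r s) = Theta (fun j => conj (α j)) k s r := by
  fin_cases r <;> fin_cases s <;> simp [Theta, rho]

theorem star_cmvL (α : ℕ → ℂ) (n : ℕ) : star (cmvL α n) = cmvL (fun j => conj (α j)) n := by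
  ext i j
  simp only [Matrix.star_apply, cmvL, Matrix.of_apply]
  by_cases h : (j : ℕ) / 2 = (i : ℕ) / 2
  · rw [if_pos h, if_pos h.symm, h, RCLike.star_def, star_Theta]
  · rw [if_neg h, if_neg (Ne.symm h), star_zero]

theorem star_cmvM (α : ℕ → ℂ) (n : ℕ) : star (cmvM α n) = cmvM (fun j => conj (α j)) n := by
  ext i j
  simp only [Matrix.star_apply, cmvM, Matrix.of_apply]
  by_cases h : ((j : ℕ) + 1) / 2 = ((i : ℕ) + 1) / 2
  · rw [if_pos h, if_pos h.symm, h]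
    split_ifs
    · simp
    · rw [RCLike.star_def, star_Theta]
  · rw [if_neg h, if_neg (Ne.symm h), star_zero]

/-- The adjoint of `𝓛` is `𝓛` for the conjugated coefficients, so that the two row formulas,
applied twice, show that the product with the adjoint fixes every vector. -/
theorem cmvL_mem_unitaryGroup {α : ℕ → ℂ} {n : ℕ} (hn : Even n) (hα : ∀ j < n, ‖α j‖ ≤ 1) :
    cmvL α n ∈ Matrix.unitaryGroup (Fin n) ℂ := by
  rw [Matrix.mem_unitaryGroup_iff, star_cmvL]
  refine Matrix.ext_of_mulVec_single fun j => ?_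
  rw [← Matrix.mulVec_mulVec, Matrix.one_mulVec]
  generalize (Pi.single j 1 : Fin n → ℂ) = x
  funext ⟨i, hi⟩
  have hρ : ∀ j, rho (fun j => conj (α j)) j = rho α j := fun j => by simp [rho]
  obtain ⟨m, rfl⟩ := hn
  obtain ⟨b, rfl | rfl⟩ := Nat.even_or_odd' i
  · have h := rho_sq_complex (hα _ hi)
    rw [cmvL_mulVec_even (by omega), cmvL_mulVec_even (by omega), cmvL_mulVec_odd (by omega), hρ,
      Complex.conj_conj]
    linear_combination x ⟨2 * b, hi⟩ * h
  · have h := rho_sq_complex (hα (2 * b) (by omega))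
    rw [cmvL_mulVec_odd (by omega), cmvL_mulVec_even (by omega), cmvL_mulVec_odd (by omega), hρ,
      Complex.conj_conj]
    linear_combination x ⟨2 * b + 1, hi⟩ * h

/-- As for `𝓛`; the last row is a `1 × 1` block, which is unitary because `|α_{n-1}| = 1`. -/
theorem cmvM_mem_unitaryGroup {α : ℕ → ℂ} {n : ℕ} (hn : Even n) (hα : ∀ j < n, ‖α j‖ ≤ 1)
    (hlast : ‖α (n - 1)‖ = 1) : cmvM α n ∈ Matrix.unitaryGroup (Fin n) ℂ := by
  rw [Matrix.mem_unitaryGroup_iff, star_cmvM]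
  refine Matrix.ext_of_mulVec_single fun j => ?_
  rw [← Matrix.mulVec_mulVec, Matrix.one_mulVec]
  generalize (Pi.single j 1 : Fin n → ℂ) = x
  funext ⟨i, hi⟩
  have hρ : ∀ j, rho (fun j => conj (α j)) j = rho α j := fun j => by simp [rho]
  obtain ⟨m, rfl⟩ := hn
  obtain ⟨b, rfl | rfl⟩ := Nat.even_or_odd' i
  · obtain - | b := b
    · exact (cmvM_mulVec_zero hi _).trans (cmvM_mulVec_zero hi x)
    · have h := rho_sq_complex (hα (2 * b + 1) (by omega))
      simp only [mul_add, mul_one] at hi ⊢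
      rw [cmvM_mulVec_even hi, cmvM_mulVec_even hi, cmvM_mulVec_odd hi, hρ, Complex.conj_conj]
      linear_combination x ⟨2 * b + 2, hi⟩ * h
  · by_cases hb : m + m = 2 * b + 2
    · have h1 : α (2 * b + 1) * conj (α (2 * b + 1)) = 1 := by
        have : m + m - 1 = 2 * b + 1 := by omega
        rw [this] at hlast
        simp [Complex.mul_conj, Complex.normSq_eq_norm_sq, hlast]
      rw [cmvM_mulVec_last hb, cmvM_mulVec_last hb, Complex.conj_conj]
      linear_combination x ⟨2 * b + 1, hi⟩ * h1
    · have h := rho_sq_complex (hα (2 * b + 1) hi)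
      have hb' : 2 * b + 2 < m + m := by omega
      rw [cmvM_mulVec_odd hb', cmvM_mulVec_even hb', cmvM_mulVec_odd hb', hρ, Complex.conj_conj]
      linear_combination x ⟨2 * b + 1, hi⟩ * h

/-! ### The eigenvectors of the CMV matrix -/

/-- The components of the eigenvector of the CMV matrix for the eigenvalue `z`: the sequence
`φ_0, y φ_1^*, y φ_2, y² φ_3^*, …` evaluated at `z`, with `y = z⁻¹`. -/
noncomputable def cmvVec (α : ℕ → ℂ) (z : ℂ) (i : ℕ) : ℂ :=
  if Even i then z⁻¹ ^ (i / 2) * (phi α i).eval z else z⁻¹ ^ (i / 2 + 1) * (phiStar α i).eval z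

/-- The image of `cmvVec` under the factor `𝓜`, for `z` in the Dirichlet data: the sequence
`φ_0^*, φ_1, y φ_2^*, y φ_3, …` evaluated at `z`, with `y = z⁻¹`. -/
noncomputable def cmvDualVec (α : ℕ → ℂ) (z : ℂ) (i : ℕ) : ℂ :=
  if Even i then z⁻¹ ^ (i / 2) * (phiStar α i).eval z else z⁻¹ ^ (i / 2) * (phi α i).eval z

theorem cmvVec_even (α : ℕ → ℂ) (z : ℂ) (b : ℕ) :
    cmvVec α z (2 * b) = z⁻¹ ^ b * (phi α (2 * b)).eval z := by
  simp [cmvVec]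

theorem cmvVec_odd (α : ℕ → ℂ) (z : ℂ) (b : ℕ) :
    cmvVec α z (2 * b + 1) = z⁻¹ ^ (b + 1) * (phiStar α (2 * b + 1)).eval z := by
  rw [cmvVec, if_neg (by simp), show (2 * b + 1) / 2 = b by omega]

theorem cmvDualVec_even (α : ℕ → ℂ) (z : ℂ) (b : ℕ) :
    cmvDualVec α z (2 * b) = z⁻¹ ^ b * (phiStar α (2 * b)).eval z := by
  simp [cmvDualVec]

theorem cmvDualVec_odd (α : ℕ → ℂ) (z : ℂ) (b : ℕ) :
    cmvDualVec α z (2 * b + 1) = z⁻¹ ^ b * (phi α (2 * b + 1)).eval z := by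
  rw [cmvDualVec, if_neg (by simp), show (2 * b + 1) / 2 = b by omega]

/-- For even `n` the factor `𝓛` does not involve the coefficient of index `n - 1`, so only the
agreement of `β` with `α` below it matters. -/
theorem cmvL_mulVec_cmvDualVec {α β : ℕ → ℂ} {n : ℕ} (hn : Even n) (hα : ∀ j, ‖α j‖ < 1)
    (hβ : ∀ j, j + 1 < n → β j = α j) {z : ℂ} (hz : z ≠ 0) :
    cmvL β n *ᵥ (fun i : Fin n => cmvDualVec α z i) = z • fun i : Fin n => cmvVec α z i := by
  funext ⟨i, hi⟩
  obtain ⟨m, rfl⟩ := hn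
  rw [Pi.smul_apply, smul_eq_mul]
  obtain ⟨b, hb⟩ := Nat.even_or_odd' i
  have hb1 : 2 * b + 1 < m + m := by omega
  have e := hβ (2 * b) hb1
  have er : rho β (2 * b) = rho α (2 * b) := by rw [rho, rho, e]
  have h := rho_sq_complex (hα (2 * b)).le
  have h1 := rho_mul_eval_phi_succ (hα (2 * b)) z
  have h2 := rho_mul_eval_phiStar_succ (hα (2 * b)) z
  have hρ : (rho α (2 * b) : ℂ) ≠ 0 := by exact_mod_cast (rho_pos (hα _)).ne'
  obtain rfl | rfl := hb
  · rw [cmvL_mulVec_even hb1, e, er, cmvDualVec_even, cmvDualVec_odd, cmvVec_even]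
    linear_combination z⁻¹ ^ b * h1
  · rw [cmvL_mulVec_odd hb1, e, er, cmvDualVec_even, cmvDualVec_odd, cmvVec_odd, pow_succ]
    refine mul_left_cancel₀ hρ ?_
    have hzz : z⁻¹ * z = 1 := inv_mul_cancel₀ hz
    linear_combination z⁻¹ ^ b * ((phiStar α (2 * b)).eval z * h - α (2 * b) * h1 - h2 -
      rho α (2 * b) * (phiStar α (2 * b + 1)).eval z * hzz)

/-- The last row of `𝓜` is the `1 × 1` block with the coefficient of index `n - 1`; `hlast` is what
it demands. -/
theorem cmvM_mulVec_cmvVec {α β : ℕ → ℂ} {n : ℕ} (hn : Even n) (hα : ∀ j, ‖α j‖ < 1)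
    (hβ : ∀ j, j + 1 < n → β j = α j) {z : ℂ} (hz : z ≠ 0)
    (hlast : conj (β (n - 1)) * (phiStar α (n - 1)).eval z = z * (phi α (n - 1)).eval z) :
    cmvM β n *ᵥ (fun i : Fin n => cmvVec α z i) = fun i : Fin n => cmvDualVec α z i := by
  funext ⟨i, hi⟩
  obtain ⟨m, rfl⟩ := hn
  have hzz : z⁻¹ * z = 1 := inv_mul_cancel₀ hz
  by_cases hi0 : i = 0
  · subst hi0
    rw [cmvM_mulVec_zero]
    simp [cmvVec, cmvDualVec, phi_zero, phiStar_zero]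
  obtain ⟨b, hb⟩ : ∃ b, i = 2 * b + 1 ∨ i = 2 * b + 2 := ⟨(i - 1) / 2, by omega⟩
  by_cases hb2 : m + m = 2 * b + 2
  · obtain rfl : i = 2 * b + 1 := by omega
    rw [show m + m - 1 = 2 * b + 1 by omega] at hlast
    rw [cmvM_mulVec_last hb2, cmvVec_odd, cmvDualVec_odd, pow_succ]
    linear_combination z⁻¹ ^ b * z⁻¹ * hlast +
      z⁻¹ ^ b * (phi α (2 * b + 1)).eval z * hzz
  have hb1 : 2 * b + 2 < m + m := by omega
  have e := hβ (2 * b + 1) hb1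
  have er : rho β (2 * b + 1) = rho α (2 * b + 1) := by rw [rho, rho, e]
  have h := rho_sq_complex (hα (2 * b + 1)).le
  have h1 := rho_mul_eval_phi_succ (hα (2 * b + 1)) z
  have h2 := rho_mul_eval_phiStar_succ (hα (2 * b + 1)) z
  have hρ : (rho α (2 * b + 1) : ℂ) ≠ 0 := by exact_mod_cast (rho_pos (hα _)).ne'
  have e1 := cmvVec_even α z (b + 1)
  have e2 := cmvDualVec_even α z (b + 1)
  simp only [mul_add, mul_one] at e1 e2
  obtain rfl | rfl := hb
  · rw [cmvM_mulVec_odd hb1, e, er, cmvVec_odd, e1, cmvDualVec_odd, pow_succ]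
    linear_combination z⁻¹ ^ b * z⁻¹ * h1 + z⁻¹ ^ b * (phi α (2 * b + 1)).eval z * hzz
  · rw [cmvM_mulVec_even hb1, e, er, cmvVec_odd, e1, e2, pow_succ]
    refine mul_left_cancel₀ hρ ?_
    linear_combination z⁻¹ ^ b * z⁻¹ * ((phiStar α (2 * b + 1)).eval z * h -
      α (2 * b + 1) * h1 - h2)

theorem norm_cmvVec (α : ℕ → ℂ) {z : ℂ} (hz : ‖z‖ = 1) (i : ℕ) :
    ‖cmvVec α z i‖ = ‖(phi α i).eval z‖ := by
  rw [cmvVec]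
  split_ifs <;> simp [hz, norm_eval_phiStar_of_norm_eq_one]

theorem norm_modified (α : ℕ → ℂ) (hα : ∀ j, ‖α j‖ < 1) (p : ℕ) :
    ‖modified α p (p - 1)‖ = 1 := by
  have h := norm_ne_zero_iff.2 (one_add_ne_zero_of_norm_lt (hα (p - 1)))
  have e : 1 + conj (α (p - 1)) = conj (1 + α (p - 1)) := by simp
  rw [modified, Function.update_self, e, norm_div, RCLike.norm_conj, div_self h]

theorem modified_of_lt (α : ℕ → ℂ) {p j : ℕ} (h : j + 1 < p) : modified α p j = α j :=
  Function.update_of_ne (by omega) _ _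

/-- Up to a constant factor, `Φ_p - Φ_p^*` is the polynomial that the recurrence gives with the
modified last coefficient. -/
theorem conj_modified_mul_eval_phiStar {α : ℕ → ℂ} (hα : ∀ j, ‖α j‖ < 1) {p : ℕ} (hp : 0 < p)
    {z : ℂ} (h : (phi α p).eval z = (phiStar α p).eval z) :
    conj (modified α p (p - 1)) * (phiStar α (p - 1)).eval z = z * (phi α (p - 1)).eval z := by
  obtain ⟨m, rfl⟩ := Nat.exists_eq_succ_of_ne_zero hp.ne'
  have h1 := rho_mul_eval_phi_succ (hα m) z
  rw [h, rho_mul_eval_phiStar_succ (hα m) z] at h1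
  have h0 := one_add_ne_zero_of_norm_lt (hα m)
  simp only [modified, Nat.succ_sub_one, Function.update_self, map_div₀, map_add, map_one,
    Complex.conj_conj]
  rw [div_mul_eq_mul_div, div_eq_iff h0]
  linear_combination h1

theorem cmv_mulVec_cmvVec {α : ℕ → ℂ} (hα : ∀ j, ‖α j‖ < 1) {p : ℕ} (hp : 0 < p)
    (hp_even : Even p) {z : ℂ} (hz : z ∈ dirichletData α p) :
    cmv (modified α p) p *ᵥ (fun i : Fin p => cmvVec α z i) =
      z • fun i : Fin p => cmvVec α z i := by
  rw [mem_dirichletData hα hp] at hz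
  have h0 : z ≠ 0 := by
    rintro rfl
    simpa using norm_eq_one_of_eval_phi_eq hα hp hz
  rw [cmv, ← Matrix.mulVec_mulVec,
    cmvM_mulVec_cmvVec hp_even hα (fun _ => modified_of_lt α) h0
      (conj_modified_mul_eval_phiStar hα hp hz),
    cmvL_mulVec_cmvDualVec hp_even hα (fun _ => modified_of_lt α) h0]

theorem norm_modified_le (α : ℕ → ℂ) (hα : ∀ j, ‖α j‖ < 1) (p j : ℕ) : ‖modified α p j‖ ≤ 1 := by
  by_cases h : j = p - 1
  · exact h ▸ (norm_modified α hα p).le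
  · rw [modified, Function.update_of_ne h]
    exact (hα j).le

theorem cmv_modified_mem_unitaryGroup {α : ℕ → ℂ} (hα : ∀ j, ‖α j‖ < 1) {p : ℕ}
    (hp_even : Even p) : cmv (modified α p) p ∈ Matrix.unitaryGroup (Fin p) ℂ :=
  mul_mem (cmvL_mem_unitaryGroup hp_even fun j _ => norm_modified_le α hα p j)
    (cmvM_mem_unitaryGroup hp_even (fun j _ => norm_modified_le α hα p j) (norm_modified α hα p))

/-! ### The spectral measure -/

section SimpleSpectrum

variable {V : Type*} [AddCommGroup V] [Module ℂ V] [FiniteDimensional ℂ V]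
  {T : Module.End ℂ V}
  {S : Finset ℂ} {v : ℂ → V}

/-- An endomorphism with as many distinct eigenvalues as the dimension has no further eigenvectors:
the given ones form a basis, and `T w = l w` kills the coordinates of `w` other than the one
at `l`. -/
theorem mem_span_of_apply_eq_smul (hS : S.card = Module.finrank ℂ V)
    (hv : ∀ z ∈ S, T.HasEigenvector z (v z)) {l : ℂ} {w : V} (hw : T w = l • w) (hw0 : w ≠ 0) :
    l ∈ S ∧ w ∈ Submodule.span ℂ {v l} := by
  have hli : LinearIndependent ℂ fun z : S => v z :=
    T.eigenvectors_linearIndependent' (fun z : S => (z : ℂ)) Subtype.coe_injective _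
      fun z => hv z z.2
  have hspan := hli.span_eq_top_of_card_eq_finrank' (by rw [Fintype.card_coe, hS])
  let b := Module.Basis.mk hli hspan.ge
  have hb : ∀ z : S, T (b z) = (z : ℂ) • b z := fun z => by
    rw [Module.Basis.mk_apply]
    exact (hv z z.2).apply_eq_smul
  have hcoord : ∀ z : S, (z : ℂ) * b.repr w z = l * b.repr w z := fun z => by
    have h : T w = ∑ s : S, ((s : ℂ) * b.repr w s) • b s := by
      conv_lhs => rw [← b.sum_repr w]
      simp only [map_sum, map_smul, hb, smul_smul, mul_comm]
    have h' := congrArg (fun x => b.repr x z) (h.symm.trans hw)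
    simpa only [b.repr_sum_self, map_smul, Finsupp.smul_apply, smul_eq_mul] using h'
  have hzero : ∀ z : S, (z : ℂ) ≠ l → b.repr w z = 0 := fun z hz =>
    (mul_eq_mul_right_iff.1 (hcoord z)).resolve_left hz
  have hl : l ∈ S := by
    by_contra hl
    exact hw0 (b.ext_elem fun z => by
      rw [hzero z fun h => hl (h ▸ z.2), map_zero, Finsupp.zero_apply])
  refine ⟨hl, Submodule.mem_span_singleton.2 ⟨b.repr w ⟨l, hl⟩, ?_⟩⟩
  conv_rhs => rw [← b.sum_repr w]
  rw [Finset.sum_eq_single (⟨l, hl⟩ : S), Module.Basis.mk_apply]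
  · intro z _ hz
    rw [hzero z fun h => hz (Subtype.ext h), zero_smul]
  · simp

theorem hasEigenvalue_iff_mem (hS : S.card = Module.finrank ℂ V)
    (hv : ∀ z ∈ S, T.HasEigenvector z (v z)) (l : ℂ) : T.HasEigenvalue l ↔ l ∈ S := by
  refine ⟨fun h => ?_, fun h => Module.End.hasEigenvalue_of_hasEigenvector (hv l h)⟩
  obtain ⟨w, hw⟩ := h.exists_hasEigenvector
  exact (mem_span_of_apply_eq_smul hS hv hw.apply_eq_smul hw.2).1

theorem eigenspace_eq_span (hS : S.card = Module.finrank ℂ V)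
    (hv : ∀ z ∈ S, T.HasEigenvector z (v z)) {l : ℂ} (hl : l ∈ S) :
    T.eigenspace l = Submodule.span ℂ {v l} := by
  refine le_antisymm (fun w hw => ?_) ?_
  · by_cases hw0 : w = 0
    · exact hw0 ▸ zero_mem _
    · exact (mem_span_of_apply_eq_smul hS hv (Module.End.mem_eigenspace_iff.1 hw) hw0).2
  · rw [Submodule.span_singleton_le_iff_mem]
    exact (hv l hl).1

end SimpleSpectrum

/-- The first `p` components of `cmvVec`, as a vector of the Euclidean space. -/
noncomputable def cmvEigenvector (α : ℕ → ℂ) (p : ℕ) (z : ℂ) : EuclideanSpace ℂ (Fin p) :=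
  WithLp.toLp 2 fun i : Fin p => cmvVec α z i

theorem norm_sq_cmvEigenvector (α : ℕ → ℂ) (p : ℕ) {z : ℂ} (hz : ‖z‖ = 1) :
    ‖cmvEigenvector α p z‖ ^ 2 = kernel α p z := by
  rw [EuclideanSpace.norm_sq_eq, kernel, Finset.sum_range]
  simp [cmvEigenvector, norm_cmvVec α hz]

/-- Since the first component of the eigenvector is `1`, the squared projection of the first basis
vector onto its line is the inverse of its squared norm. -/
theorem norm_sq_starProjection_span_cmvEigenvector (α : ℕ → ℂ) {p : ℕ} (hp : 0 < p) {z : ℂ}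
    (hz : ‖z‖ = 1) :
    ‖(Submodule.span ℂ {cmvEigenvector α p z}).starProjection
      (EuclideanSpace.single ⟨0, hp⟩ 1)‖ ^ 2 = (kernel α p z)⁻¹ := by
  have hk := kernel_pos α hp z
  have h1 : inner ℂ (cmvEigenvector α p z) (EuclideanSpace.single ⟨0, hp⟩ 1) = 1 := by
    rw [EuclideanSpace.inner_single_right]
    simp [cmvEigenvector, cmvVec, phi_zero]
  rw [Submodule.starProjection_singleton, h1, norm_smul, mul_pow, norm_sq_cmvEigenvector α p hz,
    norm_div, norm_one]
  simp only [Complex.norm_real, Complex.coe_algebraMap, RCLike.ofReal, Real.norm_of_nonneg hk.le]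
  field_simp

theorem hasEigenvector_cmvVec {α : ℕ → ℂ} (hα : ∀ j, ‖α j‖ < 1) {p : ℕ} (hp : 0 < p)
    (hp_even : Even p) {z : ℂ} (hz : z ∈ dirichletData α p) :
    Module.End.HasEigenvector (Matrix.toLin' (cmv (modified α p) p)) z
      (fun i : Fin p => cmvVec α z i) := by
  refine ⟨Module.End.mem_eigenspace_iff.2 ?_, fun h => ?_⟩
  · rw [Matrix.toLin'_apply, cmv_mulVec_cmvVec hα hp hp_even hz]
  · simpa [cmvVec, phi_zero] using congrFun h ⟨0, hp⟩

theorem hasEigenvector_cmvEigenvector {α : ℕ → ℂ} (hα : ∀ j, ‖α j‖ < 1) {p : ℕ} (hp : 0 < p)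
    (hp_even : Even p) {z : ℂ} (hz : z ∈ dirichletData α p) :
    Module.End.HasEigenvector (Matrix.toEuclideanLin (cmv (modified α p) p)) z
      (cmvEigenvector α p z) := by
  have h := hasEigenvector_cmvVec hα hp hp_even hz
  refine ⟨Module.End.mem_eigenspace_iff.2 ?_, fun h0 => h.2 (congrArg WithLp.ofLp h0)⟩
  rw [cmvEigenvector, Matrix.toLpLin_toLp, h.apply_eq_smul, WithLp.toLp_smul]

theorem spectralMeasure_cmv_modified {α : ℕ → ℂ} (hα : ∀ j, ‖α j‖ < 1) {p : ℕ} (hp : 0 < p)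
    (hp_even : Even p) :
    spectralMeasure (cmv (modified α p) p) (EuclideanSpace.single ⟨0, hp⟩ 1) =
      ∑ z ∈ dirichletData α p, ENNReal.ofReal (weight α p z) • Measure.dirac z := by
  have hcard : (dirichletData α p).card = Module.finrank ℂ (EuclideanSpace ℂ (Fin p)) := by
    rw [card_dirichletData hα hp, finrank_euclideanSpace_fin]
  have hv := fun z hz => hasEigenvector_cmvEigenvector (z := z) hα hp hp_even hz
  rw [spectralMeasure, Measure.sum_fintype]
  have hmem := hasEigenvalue_iff_mem hcard hv
  refine Finset.sum_bij (fun l _ => (l : ℂ)) (fun l _ => (hmem _).1 l.2)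
    (fun _ _ _ _ h => Subtype.ext h) (fun z hz => ⟨⟨z, (hmem z).2 hz⟩, Finset.mem_univ _, rfl⟩)
    fun l _ => ?_
  have hl : (l : ℂ) ∈ dirichletData α p := (hmem _).1 l.2
  have hz := norm_eq_one_of_eval_phi_eq hα hp ((mem_dirichletData hα hp).1 hl)
  simp only [eigenspace_eq_span hcard hv hl]
  rw [norm_sq_starProjection_span_cmvEigenvector α hp hz, weight_eq hα p hz]

end OPUC

/-- The first conjunct says that the polynomials `Phi α n` and `phi α n` are the monic orthogonal
and the orthonormal polynomials of the measure with Verblunsky coefficients `α`. -/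
theorem theorem2p1 (p : ℕ) (hp : 0 < p) (hp_even : Even p) (α : ℕ → ℂ)
    (hα : ∀ j, ‖α j‖ < 1) (hα_per : Function.Periodic α p) :
    (∀ μ : Measure ℂ, IsProbabilityMeasure μ → OPUC.HasVerblunskyCoeffs μ α →
      (∀ n, OPUC.IsMonicOrthogonal μ n (OPUC.Phi α n)) ∧
        OPUC.IsOrthonormalPolynomials μ (OPUC.phi α)) ∧
    ((OPUC.dirichletData α p).card = p ∧ ∀ z ∈ OPUC.dirichletData α p, ‖z‖ = 1) ∧
    ‖OPUC.modified α p (p - 1)‖ = 1 ∧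
    OPUC.cmv (OPUC.modified α p) p ∈ Matrix.unitaryGroup (Fin p) ℂ ∧
    (∀ z ∈ OPUC.dirichletData α p, 0 < OPUC.weight α p z) ∧
    OPUC.spectralMeasure (OPUC.cmv (OPUC.modified α p) p) (EuclideanSpace.single ⟨0, hp⟩ 1) =
      ∑ z ∈ OPUC.dirichletData α p,
        ENNReal.ofReal (OPUC.weight α p z) • Measure.dirac z ∧
    ∀ z : ℂ, Module.End.HasEigenvalue (Matrix.toLin' (OPUC.cmv (OPUC.modified α p) p)) z ↔
      z ∈ OPUC.dirichletData α p := by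
  have hcircle : ∀ z ∈ OPUC.dirichletData α p, ‖z‖ = 1 := fun z hz =>
    OPUC.norm_eq_one_of_eval_phi_eq hα hp ((OPUC.mem_dirichletData hα hp).1 hz)
  refine ⟨fun μ _ h => ⟨h.isMonicOrthogonal_Phi, h.isOrthonormalPolynomials_phi hα⟩,
    ⟨OPUC.card_dirichletData hα hp, hcircle⟩, OPUC.norm_modified α hα p,
    OPUC.cmv_modified_mem_unitaryGroup hα hp_even, fun z hz => ?_,
    OPUC.spectralMeasure_cmv_modified hα hp hp_even, ?_⟩
  · rw [OPUC.weight_eq hα p (hcircle z hz)]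
    exact inv_pos.2 (OPUC.kernel_pos α hp z)
  · exact OPUC.hasEigenvalue_iff_mem
      (by rw [OPUC.card_dirichletData hα hp, Module.finrank_fin_fun])
      fun z hz => OPUC.hasEigenvector_cmvVec hα hp hp_even hz
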